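/- Let $G$ be a finite connected simple graph. A proper $k$-coloring of $G$ is a map $c$ from $V(G)$ onto $\{1,\dots,k\}$ such that adjacent vertices get different colors; its color classes are the (nonempty) sets $V_i=c^{-1}(i)$. The color code of a vertex $v$ is the $k$-tuple $(d(v,V_1),\dots,d(v,V_k))$, where $d(v,V_i)=\min\{d(v,x) : x\in V_i\}$ and $d$ is the graph distance. The coloring $c$ is locating if distinct vertices have distinct color codes, and the locating chromatic number $\chi_L(G)$ is the minimum $k$ for which $G$ has a locating $k$-coloring. Let $K_m$ be the complete graph on $m$ vertices, $P_n$ the path on $n$ vertices, and $\square$ the Cartesian product of graphs. Theorem. Let $m\ge 3$ and $n\ge 2$ be integers. Then $$\chi_L(K_m\,\square\,P_n)=\begin{cases} m+2 & \text{if } m\le n-2,\\ m+1 & \text{if } m\ge n-1.\end{cases}$$ -/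

import Mathlib

namespace LocatingColoring

variable {V : Type*}

/-- The distance `d(u, S) = min {d(u, x) | x ∈ S}` from a vertex `u` to a set `S` of vertices,
for a connected graph `G` and a nonempty set `S`. -/
noncomputable def distToSet (G : SimpleGraph V) (u : V) (S : Set V) : ℕ :=
  sInf {d : ℕ | ∃ x ∈ S, d = G.dist u x}

/-- The color code of the vertex `v` with respect to the proper `k`-coloring `c`: the `k`-tuple of
the distances from `v` to the color classes of `c`. -/
noncomputable def colorCode {G : SimpleGraph V} {k : ℕ} (c : G.Coloring (Fin k)) (v : V) :
    Fin k → ℕ :=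
  fun i => distToSet G v (c.colorClass i)

/-- A proper `k`-coloring is locating if all `k` colors are used (every color class is nonempty)
and distinct vertices have distinct color codes. -/
structure IsLocating {G : SimpleGraph V} {k : ℕ} (c : G.Coloring (Fin k)) : Prop where
  surjective : Function.Surjective c
  injective_colorCode : Function.Injective (colorCode c)

/-- The locating chromatic number of a connected graph `G`: the minimum number of colors in a
locating coloring of `G`. -/
noncomputable def locatingChromaticNumber (G : SimpleGraph V) : ℕ :=
  sInf {k : ℕ | ∃ c : G.Coloring (Fin k), IsLocating c}

end LocatingColoring

/-! Call the copies of `K_m` rows. A color present in a row is at distance at most one from every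
vertex of that row, so a code carries information beyond the vertex's color only at colors missing
from its row. With `m` colors nothing is missing and codes depend on color alone (`le_colors`). With
`m + 1` colors each row misses one color. Adjacent rows miss different ones
(`missed_ne_of_adjacent`), so each row has a vertex whose code has all entries at most one. These
vertices need distinct colors, whence `n ≤ m + 1` (`rows_le_of_isLocating`). Cyclic colorings give
the upper bounds: `exists_isLocating_of_rows_le` for `n ≤ m + 1`, `exists_isLocating_add_two`
always. -/

namespace SimpleGraph

/-! ### Distances in the path and in the product. -/

/-- The value of a vertex changes by at most one along each edge of a path graph. -/
theorem Walk.val_sub_le_length_pathGraph {n : ℕ} {u v : Fin n} (p : (pathGraph n).Walk u v) :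
    (u.val - v.val) + (v.val - u.val) ≤ p.length := by
  induction p with
  | nil => simp
  | cons h p ih =>
    rw [pathGraph_adj] at h
    rw [Walk.length_cons]
    omega

theorem exists_walk_pathGraph {n : ℕ} (d : ℕ) (u v : Fin n) (h : u.val + d = v.val) :
    ∃ p : (pathGraph n).Walk u v, p.length = d := by
  induction d generalizing u with
  | zero =>
    obtain rfl : u = v := Fin.ext (by omega)
    exact ⟨Walk.nil, rfl⟩
  | succ d ih =>
    have hlt : u.val + 1 < n := by have := v.isLt; omega
    obtain ⟨p, hp⟩ := ih ⟨u.val + 1, hlt⟩ (by simp only; omega)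
    have hadj : (pathGraph n).Adj u ⟨u.val + 1, hlt⟩ := by rw [pathGraph_adj]; simp
    exact ⟨Walk.cons hadj p, by simp [hp]⟩

/-- With truncated subtraction one summand is zero, so the sum is the absolute difference. -/
theorem dist_pathGraph {n : ℕ} (u v : Fin n) :
    (pathGraph n).dist u v = (u.val - v.val) + (v.val - u.val) := by
  apply le_antisymm
  · rcases le_total u.val v.val with h | h
    · obtain ⟨p, hp⟩ := exists_walk_pathGraph (v.val - u.val) u v (by omega)
      have := dist_le p
      omega
    · obtain ⟨p, hp⟩ := exists_walk_pathGraph (u.val - v.val) v u (by omega)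
      have := dist_le p
      rw [dist_comm]
      omega
  · obtain ⟨p, hp⟩ := (pathGraph_preconnected n u v).exists_walk_length_eq_dist
    rw [← hp]
    exact p.val_sub_le_length_pathGraph

theorem dist_boxProd_complete_path {m n : ℕ} (x y : Fin m × Fin n) :
    (completeGraph (Fin m) □ pathGraph n).dist x y =
      (if x.1 = y.1 then 0 else 1) + ((x.2.val - y.2.val) + (y.2.val - x.2.val)) := by
  have h1 : (completeGraph (Fin m)).edist x.1 y.1 = ((if x.1 = y.1 then 0 else 1 : ℕ) : ℕ∞) := by
    rw [completeGraph_eq_top, edist_top]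
    split_ifs <;> rfl
  have h2 : (pathGraph n).edist x.2 y.2 = ((x.2.val - y.2.val) + (y.2.val - x.2.val) : ℕ) := by
    rw [← dist_pathGraph, (pathGraph_preconnected n x.2 y.2).coe_dist_eq_edist]
  rw [dist, edist_boxProd, h1, h2, ← Nat.cast_add, ENat.toNat_natCast]

end SimpleGraph

namespace LocatingColoring

open SimpleGraph

/-! ### Color codes in a general graph. -/

section General

variable {V : Type*} {G : SimpleGraph V} {k : ℕ} {c : G.Coloring (Fin k)}

theorem colorCode_le {v u : V} {i : Fin k} (h : c u = i) : colorCode c v i ≤ G.dist v u :=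
  Nat.sInf_le ⟨u, h, rfl⟩

/-- Surjectivity is needed because `sInf ∅ = 0` in `ℕ`. -/
theorem exists_dist_eq_colorCode (hc : Function.Surjective c) (v : V) (i : Fin k) :
    ∃ u, c u = i ∧ colorCode c v i = G.dist v u := by
  obtain ⟨u, hu⟩ := hc i
  exact Nat.sInf_mem (s := {d : ℕ | ∃ x ∈ c.colorClass i, d = G.dist v x}) ⟨_, u, hu, rfl⟩

theorem colorCode_self (v : V) : colorCode c v (c v) = 0 := by
  have := colorCode_le (c := c) (v := v) (u := v) rfl
  rw [dist_self] at this
  omega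

theorem colorCode_pos (hG : G.Preconnected) (hc : Function.Surjective c) {v : V} {i : Fin k}
    (h : c v ≠ i) : 0 < colorCode c v i := by
  obtain ⟨u, hu, e⟩ := exists_dist_eq_colorCode hc v i
  rw [e]
  exact (hG v u).pos_dist_of_ne fun e => h (e ▸ hu)

/-- In a locating coloring, two vertices of the same color coincide as soon as their codes agree at
all colors at which one of the codes is at least two. -/
theorem IsLocating.eq_of_colorCode (hG : G.Preconnected) (hc : IsLocating c) {v w : V}
    (h : c v = c w)
    (hvw : ∀ i, colorCode c v i = colorCode c w i ∨
      colorCode c v i ≤ 1 ∧ colorCode c w i ≤ 1) : v = w := by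
  refine hc.injective_colorCode (funext fun i => ?_)
  by_cases hi : c v = i
  · subst hi
    rw [colorCode_self, h, colorCode_self]
  · have h1 := colorCode_pos hG hc.surjective hi
    have h2 := colorCode_pos hG hc.surjective (h ▸ hi)
    rcases hvw i with h | h <;> omega

/-- A surjective coloring is locating if any two vertices of the same color have distinct codes. -/
theorem isLocating_of_same_color (hG : G.Preconnected) (hc : Function.Surjective c)
    (h : ∀ v w, c v = c w → colorCode c v = colorCode c w → v = w) : IsLocating c := by
  refine ⟨hc, fun v w e => h v w ?_ e⟩
  by_contra hne
  have h1 := colorCode_pos hG hc (Ne.symm hne)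
  rw [← e, colorCode_self] at h1
  exact h1.false

end General

/-! ### Colors in a row; at least `m + 1` colors. -/

section Product

variable {m n : ℕ}

theorem preconnected_complete_path :
    (completeGraph (Fin m) □ pathGraph n).Preconnected := by
  rw [completeGraph_eq_top]
  exact preconnected_top.boxProd (pathGraph_preconnected n)

variable {k : ℕ} {c : (completeGraph (Fin m) □ pathGraph n).Coloring (Fin k)}

theorem row_injective {i j : Fin m} {a : Fin n} (h : c (i, a) = c (j, a)) : i = j := by
  by_contra hij
  exact c.valid (v := (i, a)) (w := (j, a)) (by simp [hij]) h

theorem column_ne {i : Fin m} {a b : Fin n} (h : a.val + 1 = b.val) : c (i, a) ≠ c (i, b) :=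
  c.valid (by simp [pathGraph_adj, h])

theorem colorCode_le_one {i j : Fin m} {a : Fin n} {x : Fin k} (h : c (j, a) = x) :
    colorCode c (i, a) x ≤ 1 := by
  refine (colorCode_le h).trans ?_
  rw [dist_boxProd_complete_path]
  simp only
  split_ifs <;> omega

/-- An injective map into a set with one more element misses exactly one value. -/
theorem exists_missed (g : Fin m → Fin (m + 1)) (hg : Function.Injective g) :
    ∃ z, ∀ x, (∃ i, g i = x) ↔ x ≠ z := by
  have hcard : (Finset.univ.image g)ᶜ.card = 1 := by
    rw [Finset.card_compl, Finset.card_image_of_injective _ hg]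
    simp
  obtain ⟨z, hz⟩ := Finset.card_eq_one.mp hcard
  refine ⟨z, fun x => ?_⟩
  have := congrArg (x ∈ ·) hz
  simp only [Finset.mem_compl, Finset.mem_image, Finset.mem_univ, true_and,
    Finset.mem_singleton, eq_iff_iff] at this
  tauto

/-- A coloring with one color more than there are columns misses exactly one color in each row. -/
theorem exists_missed_color (c : (completeGraph (Fin m) □ pathGraph n).Coloring (Fin (m + 1))) :
    ∃ f : Fin n → Fin (m + 1), ∀ a x, (∃ i, c (i, a) = x) ↔ x ≠ f a := by
  choose f hf using fun a => exists_missed (fun i => c (i, a)) fun _ _ h => row_injective h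
  exact ⟨f, hf⟩

theorem le_colors (hn : 2 ≤ n) (hm : 3 ≤ m) (hc : IsLocating c) : m + 1 ≤ k := by
  let a : Fin n := ⟨0, by omega⟩
  let b : Fin n := ⟨1, by omega⟩
  have hinj : ∀ a : Fin n, Function.Injective fun i => c (i, a) := fun _ _ _ h => row_injective h
  have hle : m ≤ k := by simpa using Fintype.card_le_of_injective _ (hinj a)
  by_contra hlt
  obtain rfl : k = m := by omega
  have hsurj : ∀ a : Fin n, Function.Surjective fun i => c (i, a) := fun a =>
    Finite.surjective_of_injective (hinj a)
  have hcode : ∀ v x, colorCode c v x ≤ 1 := fun v x => by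
    obtain ⟨j, hj⟩ := hsurj v.2 x
    exact colorCode_le_one (i := v.1) hj
  let i : Fin k := ⟨0, by omega⟩
  obtain ⟨j, hj⟩ := hsurj b (c (i, a))
  have := hc.eq_of_colorCode preconnected_complete_path hj.symm
    fun x => Or.inr ⟨hcode _ x, hcode _ x⟩
  simp [a, b] at this

/-! ### Colorings with `m + 1` colors: the bound on rows. -/

section OneMissing

variable {c : (completeGraph (Fin m) □ pathGraph n).Coloring (Fin (m + 1))}
  {f : Fin n → Fin (m + 1)}

theorem missed_ne_color (hf : ∀ a x, (∃ i, c (i, a) = x) ↔ x ≠ f a) {v : Fin m × Fin n} :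
    f v.2 ≠ c v := ((hf v.2 (c v)).mp ⟨v.1, rfl⟩).symm

/-- If row `b` is the only row at distance `t` from row `p` that contains the color `z`, and no such
row is nearer, then all but one vertex of row `p` have distance `t + 1` from `z`. -/
theorem colorCode_eq_of_nearest_row (hc : IsLocating c)
    (hf : ∀ a x, (∃ i, c (i, a) = x) ↔ x ≠ f a) {p q b : Fin n} {z : Fin (m + 1)} {t : ℕ}
    (hpq : p.val + 1 = q.val ∨ q.val + 1 = p.val)
    (hb : (p.val - b.val) + (b.val - p.val) = t)
    (hmin : ∀ b', z ≠ f b' → t ≤ (p.val - b'.val) + (b'.val - p.val) ∧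
      t ≤ (q.val - b'.val) + (b'.val - q.val))
    (hbq : (q.val - b.val) + (b.val - q.val) = t + 1) {i j : Fin m} (hj : c (j, b) = z)
    (hij : i ≠ j) : colorCode c (i, p) z = t + 1 := by
  apply le_antisymm
  · refine (colorCode_le hj).trans ?_
    rw [dist_boxProd_complete_path]
    simp only [hij, if_false]
    omega
  · obtain ⟨⟨l, b'⟩, hu, e⟩ := exists_dist_eq_colorCode hc.surjective (i, p) z
    rw [e, dist_boxProd_complete_path]
    have := hmin b' ((hf b' z).mp ⟨l, hu⟩)
    by_cases hbb : b' = b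
    · subst hbb
      obtain rfl : l = j := row_injective (hu.trans hj.symm)
      simp only [hij, if_false]
      omega
    · have : b'.val ≠ b.val := fun h => hbb (Fin.ext h)
      simp only
      -- A second row at distance `t` from `p` would mirror `b` and be at distance `t - 1` from `q`,
      -- against `hmin`.
      omega

/-- Rows `p` and `q` carry the same colors, and equally colored vertices in them can be told apart
only by the distance to `f p`. That distance is `t + 1` for too many vertices. -/
theorem false_of_nearest_row (hm : 3 ≤ m) (hc : IsLocating c)
    (hf : ∀ a x, (∃ i, c (i, a) = x) ↔ x ≠ f a) {p q b : Fin n} {t : ℕ}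
    (hpq : p.val + 1 = q.val ∨ q.val + 1 = p.val) (hfpq : f p = f q) (hbz : f p ≠ f b)
    (hb : (p.val - b.val) + (b.val - p.val) = t)
    (hmin : ∀ b', f p ≠ f b' → t ≤ (p.val - b'.val) + (b'.val - p.val) ∧
      t ≤ (q.val - b'.val) + (b'.val - q.val))
    (hbq : (q.val - b.val) + (b.val - q.val) = t + 1) : False := by
  obtain ⟨j, hj⟩ := (hf b (f p)).mpr hbz
  have hp : ∀ i, i ≠ j → colorCode c (i, p) (f p) = t + 1 := fun i hij =>
    colorCode_eq_of_nearest_row hc hf hpq hb hmin hbq hj hij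
  have key : ∀ i i', c (i, p) = c (i', q) →
      colorCode c (i, p) (f p) ≠ colorCode c (i', q) (f p) := by
    intro i i' h e
    have := hc.eq_of_colorCode preconnected_complete_path h fun x => by
      by_cases hx : x = f p
      · exact Or.inl (hx ▸ e)
      · obtain ⟨l, hl⟩ := (hf p x).mpr hx
        obtain ⟨l', hl'⟩ := (hf q x).mpr (hfpq ▸ hx)
        exact Or.inr ⟨colorCode_le_one hl, colorCode_le_one hl'⟩
    have h2 : p.val = q.val := congrArg (fun v => v.2.val) this
    omega
  have hne : ∀ i, c (i, p) ≠ c (i, q) := fun i => by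
    rcases hpq with h | h
    · exact column_ne h
    · exact (column_ne h).symm
  -- If `f p` also occurs at distance `t` from `q`, on the other side, the `m - 1 ≥ 2` vertices of
  -- row `p` off column `j` must all share the color of `(j', q)`. Otherwise `(j, q)` clashes with
  -- its namesake in row `p`, which is off column `j` by properness.
  by_cases hex : ∃ b', f p ≠ f b' ∧ (q.val - b'.val) + (b'.val - q.val) = t
  · obtain ⟨b', hb'z, hb'⟩ := hex
    obtain ⟨j', hj'⟩ := (hf b' (f p)).mpr hb'z
    have hq : ∀ i, i ≠ j' → colorCode c (i, q) (f p) = t + 1 := fun i hij =>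
      colorCode_eq_of_nearest_row hc hf (p := q) (q := p) hpq.symm hb'
        (fun b hb => (hmin b hb).symm) (by have := (hmin b' hb'z).1; omega) hj' hij
    have hq' : ∀ i, i ≠ j → c (i, p) = c (j', q) := fun i hij => by
      obtain ⟨i', hi'⟩ := (hf q (c (i, p))).mpr (hfpq ▸ (missed_ne_color hf (v := (i, p))).symm)
      by_cases h : i' = j'
      · rw [← hi', h]
      · exact absurd ((hp i hij).trans (hq i' h).symm) (key i i' hi'.symm)
    obtain ⟨i₁, h₁, i₂, h₂, h⟩ : ∃ i₁, i₁ ≠ j ∧ ∃ i₂, i₂ ≠ j ∧ i₁ ≠ i₂ := by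
      have : 1 < (Finset.univ.erase j).card := by
        rw [Finset.card_erase_of_mem (Finset.mem_univ j), Finset.card_univ, Fintype.card_fin]
        omega
      obtain ⟨i₁, h₁, i₂, h₂, h⟩ := Finset.one_lt_card.mp this
      exact ⟨i₁, Finset.ne_of_mem_erase h₁, i₂, Finset.ne_of_mem_erase h₂, h⟩
    exact h (row_injective ((hq' i₁ h₁).trans (hq' i₂ h₂).symm))
  · have hq : colorCode c (j, q) (f p) = t + 1 := by
      apply le_antisymm
      · refine (colorCode_le hj).trans ?_
        rw [dist_boxProd_complete_path]
        simp only [if_true]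
        omega
      · obtain ⟨⟨l, b'⟩, hu, e⟩ := exists_dist_eq_colorCode hc.surjective (j, q) (f p)
        rw [e, dist_boxProd_complete_path]
        have h1 := (hf b' (f p)).mp ⟨l, hu⟩
        have h2 := (hmin b' h1).2
        have h3 : (q.val - b'.val) + (b'.val - q.val) ≠ t := fun h => hex ⟨b', h1, h⟩
        simp only
        omega
    obtain ⟨i, hi⟩ := (hf p (c (j, q))).mpr (hfpq ▸ (missed_ne_color hf (v := (j, q))).symm)
    have hij : i ≠ j := fun h => hne j (h ▸ hi)
    exact key i j hi ((hp i hij).trans hq.symm)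

/-- Adjacent rows miss different colors. -/
theorem missed_ne_of_adjacent (hm : 3 ≤ m) (hc : IsLocating c)
    (hf : ∀ a x, (∃ i, c (i, a) = x) ↔ x ≠ f a) {p q : Fin n} (hpq : p.val + 1 = q.val) :
    f p ≠ f q := by
  intro hfpq
  obtain ⟨⟨l, b₀⟩, hl⟩ := hc.surjective (f p)
  have hne : (Finset.univ.filter fun b => f p ≠ f b).Nonempty :=
    ⟨b₀, by simpa using (hf b₀ (f p)).mp ⟨l, hl⟩⟩
  -- A row containing `f p` is neither `p` nor `q`, so this sum is `2t + 1` with `t` the distance to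
  -- the nearer of the two.
  obtain ⟨b, hb, hmin⟩ := Finset.exists_min_image _
    (fun b : Fin n => ((p.val - b.val) + (b.val - p.val)) + ((q.val - b.val) + (b.val - q.val))) hne
  simp only [Finset.mem_filter, Finset.mem_univ, true_and] at hb hmin
  rcases le_total b.val p.val with h | h
  · refine false_of_nearest_row hm hc hf (Or.inl hpq) hfpq hb rfl (fun b' hb' => ?_) (by omega)
    have := hmin b' hb'
    omega
  · have hbp : b.val ≠ p.val := fun h => hb (congrArg f (Fin.ext h).symm)
    refine false_of_nearest_row hm hc hf (Or.inr hpq) hfpq.symm (hfpq ▸ hb) rfl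
      (fun b' hb' => ?_) (by omega)
    have := hmin b' (hfpq ▸ hb')
    omega

theorem rows_le_of_isLocating (hm : 3 ≤ m) (hn : 2 ≤ n) (hc : IsLocating c) : n ≤ m + 1 := by
  obtain ⟨f, hf⟩ := exists_missed_color c
  have hspecial : ∀ a : Fin n, ∃ j, ∀ x, colorCode c (j, a) x ≤ 1 := by
    intro a
    obtain ⟨b, hab, hfab⟩ : ∃ b : Fin n, (a.val + 1 = b.val ∨ b.val + 1 = a.val) ∧ f a ≠ f b := by
      by_cases h : a.val + 1 < n
      · exact ⟨⟨a.val + 1, h⟩, Or.inl rfl, missed_ne_of_adjacent hm hc hf rfl⟩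
      · have h' : a.val - 1 + 1 = a.val := by omega
        exact ⟨⟨a.val - 1, by omega⟩, Or.inr h', (missed_ne_of_adjacent hm hc hf h').symm⟩
    obtain ⟨j, hj⟩ := (hf b (f a)).mpr hfab
    refine ⟨j, fun x => ?_⟩
    by_cases hx : x = f a
    · subst hx
      refine (colorCode_le hj).trans ?_
      rw [dist_boxProd_complete_path]
      simp only [if_true]
      omega
    · obtain ⟨i, hi⟩ := (hf a x).mpr hx
      exact colorCode_le_one hi
  choose j hj using hspecial
  have hinj : Function.Injective fun a => c (j a, a) := fun a b h =>
    congrArg Prod.snd (hc.eq_of_colorCode preconnected_complete_path h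
      fun x => Or.inr ⟨hj a x, hj b x⟩)
  simpa using Fintype.card_le_of_injective _ hinj

end OneMissing

/-! ### A coloring with `m + 1` colors when `n ≤ m + 1`. -/

/-- The offset of the color of the vertex in row `a` and column `j` from the color `a` that is
missed by the row. -/
def offset (m j a : ℕ) : ℕ :=
  if 3 ≤ j then j else if (a + 2 * j) % 3 = 0 then 2 else if (a + 2 * j) % 3 = 2 then 1 else m

/-- Down each of the first three columns the offset cycles through `2, m, 1`. As `m ≡ -1` modulo `m
+ 1`, only the vertex of offset `2` in row `a` can be next to the missed color `a`. Its color `a +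
2` differs from row to row. -/
theorem exists_isLocating_of_rows_le (hm : 3 ≤ m) (hn : 2 ≤ n) (hnm : n ≤ m + 1) :
    ∃ c : (completeGraph (Fin m) □ pathGraph n).Coloring (Fin (m + 1)), IsLocating c := by
  let F : ℕ → ℕ → ℕ := fun j a =>
    if a + offset m j a ≤ m then a + offset m j a else a + offset m j a - (m + 1)
  have hoff : ∀ j a, j < m → 1 ≤ offset m j a ∧ offset m j a ≤ m := by
    intro j a hj
    unfold offset
    split_ifs <;> omega
  have hF : ∀ j a, j < m → a < n → F j a < m + 1 := by
    intro j a hj ha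
    have := hoff j a hj
    simp only [F]
    split_ifs <;> omega
  have hrow : ∀ i j a, i < m → j < m → F i a = F j a → i = j := by
    intro i j a hi hj h
    have h1 := hoff i a hi
    have h2 := hoff j a hj
    have h3 : offset m i a = offset m j a := by
      simp only [F] at h
      split_ifs at h <;> omega
    unfold offset at h3
    split_ifs at h3 <;> omega
  have hcol : ∀ j a, j < m → a + 1 < n → F j a ≠ F j (a + 1) := by
    intro j a hj ha h
    have h1 := hoff j a hj
    have h2 := hoff j (a + 1) hj
    have h3 : offset m j a = offset m j (a + 1) + 1 ∨
        offset m j a + (m + 1) = offset m j (a + 1) + 1 := by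
      simp only [F] at h
      split_ifs at h <;> omega
    unfold offset at h3
    split_ifs at h3 <;> omega
  have hmiss : ∀ j a, j < m → a < n → F j a ≠ a := by
    intro j a hj ha h
    have := hoff j a hj
    simp only [F] at h
    split_ifs at h <;> omega
  have hspecial : ∀ j a b, j < m → a < n → b < n → (a + 1 = b ∨ b + 1 = a) → F j b = a →
      offset m j a = 2 := by
    intro j a b hj ha hb hab h
    have h1 := hoff j b hj
    have h2 : (a + 1 = b ∧ offset m j b = m) ∨ (b + 1 = a ∧ offset m j b = 1) := by
      simp only [F] at h
      split_ifs at h <;> omega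
    unfold offset at h2 ⊢
    split_ifs at h2 ⊢ <;> omega
  let c : (completeGraph (Fin m) □ pathGraph n).Coloring (Fin (m + 1)) :=
    Coloring.mk (fun v => ⟨F v.1 v.2, hF _ _ v.1.isLt v.2.isLt⟩) (by
      rintro ⟨i, a⟩ ⟨j, b⟩ hadj h
      have h := congrArg Fin.val h
      simp only [boxProd_adj, completeGraph_eq_top, top_adj, pathGraph_adj] at hadj h
      rcases hadj with ⟨hij, rfl⟩ | ⟨hab | hab, rfl⟩
      · exact hij (Fin.ext (hrow _ _ _ i.isLt j.isLt h))
      · rw [← hab] at h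
        exact hcol i a i.isLt (by omega) h
      · rw [← hab] at h
        exact hcol i b i.isLt (by omega) h.symm)
  have hval : ∀ j a, (c (j, a)).val = F j a := fun _ _ => rfl
  obtain ⟨f, hf⟩ := exists_missed_color c
  have hfa : ∀ a, (f a).val = a.val := fun a => by
    have : ¬ ∃ i, c (i, a) = ⟨a.val, by omega⟩ := by
      rintro ⟨i, hi⟩
      exact hmiss i a i.isLt a.isLt (congrArg Fin.val hi)
    rw [hf, not_not] at this
    rw [← this]
  have hsurj : Function.Surjective c := fun x => by
    by_cases hx : x = f ⟨0, by omega⟩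
    · obtain ⟨i, hi⟩ := (hf ⟨1, by omega⟩ x).mpr fun h => by
        have := congrArg Fin.val (hx.symm.trans h)
        simp [hfa] at this
      exact ⟨_, hi⟩
    · obtain ⟨i, hi⟩ := (hf _ x).mpr hx
      exact ⟨_, hi⟩
  have honly : ∀ (i : Fin m) (a : Fin n), colorCode c (i, a) (f a) ≤ 1 →
      offset m i a = 2 := by
    intro i a h
    obtain ⟨⟨l, b⟩, hu, e⟩ := exists_dist_eq_colorCode hsurj (i, a) (f a)
    rw [e, dist_boxProd_complete_path] at h
    have hab : a.val ≠ b.val := fun hab => by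
      have hab := Fin.ext hab
      subst hab
      exact (hf a (f a)).mp ⟨l, hu⟩ rfl
    by_cases hil : i = l
    · subst hil
      simp only [if_true] at h
      refine hspecial i a b i.isLt a.isLt b.isLt (by omega) ?_
      rw [← hval, hu, hfa]
    · simp only [hil, if_false] at h
      omega
  refine ⟨c, isLocating_of_same_color preconnected_complete_path hsurj ?_⟩
  rintro ⟨i, a⟩ ⟨j, b⟩ hcol hcode
  by_cases hab : a = b
  · subst hab
    rw [row_injective hcol]
  -- Row `b` contains `f a` and row `a` contains `f b`, so equal codes force offset `2` at both
  -- vertices.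
  · have hfab : f a ≠ f b := fun h => hab (Fin.ext (by rw [← hfa, h, hfa]))
    have h1 := honly i a (by
      obtain ⟨l, hl⟩ := (hf b (f a)).mpr hfab
      rw [hcode]
      exact colorCode_le_one hl)
    have h2 := honly j b (by
      obtain ⟨l, hl⟩ := (hf a (f b)).mpr hfab.symm
      rw [← hcode]
      exact colorCode_le_one hl)
    have h3 := congrArg Fin.val hcol
    simp only [hval, F, h1, h2] at h3
    refine absurd (Fin.ext ?_) hab
    split_ifs at h3 <;> omega

/-! ### A coloring with `m + 2` colors for every `n`. -/

/-- Color `m + 1` occurs only at the corner `(0, 0)`, so its code entry is the row number, plus one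
off column `0`. This leaves only collisions between row `a` off column `0` and row `a + 1` in column
`0`. -/
theorem exists_isLocating_add_two (hm : 3 ≤ m) (hn : 2 ≤ n) :
    ∃ c : (completeGraph (Fin m) □ pathGraph n).Coloring (Fin (m + 2)), IsLocating c := by
  let P : ℕ → ℕ := fun j => if j = 0 then m else j
  let F : ℕ → ℕ → ℕ := fun j a =>
    if j = 0 ∧ a = 0 then m + 1 else (a + P j) % (m + 1)
  have hcancel : ∀ a x y, x < m + 1 → y < m + 1 →
      (a + x) % (m + 1) = (a + y) % (m + 1) → x = y := by
    intro a x y hx hy h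
    have : x % (m + 1) = y % (m + 1) := Nat.ModEq.add_left_cancel' a h
    rwa [Nat.mod_eq_of_lt hx, Nat.mod_eq_of_lt hy] at this
  have hsucc : ∀ x, x < m + 1 → (x + 1) % (m + 1) = if x = m then 0 else x + 1 := by
    intro x hx
    split_ifs with h
    · simp [h]
    · exact Nat.mod_eq_of_lt (by omega)
  have hnext : ∀ a x y, x < m + 1 → y < m + 1 →
      (a + x) % (m + 1) = (a + 1 + y) % (m + 1) → x = if y = m then 0 else y + 1 := by
    intro a x y hx hy h
    rw [← hsucc y hy]
    refine hcancel a _ _ hx (Nat.mod_lt _ (by omega)) ?_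
    rw [h, Nat.add_mod_mod]
    congr 1
    omega
  have hP : ∀ j, j < m → 1 ≤ P j ∧ P j ≤ m := by
    intro j hj
    simp only [P]
    split_ifs <;> omega
  have hlt : ∀ x, x % (m + 1) < m + 1 := fun x => Nat.mod_lt _ (by omega)
  have hF : ∀ j a, F j a < m + 2 := by
    intro j a
    have := hlt (a + P j)
    simp only [F]
    split_ifs <;> omega
  have hrow : ∀ i j a, i < m → j < m → F i a = F j a → i = j := by
    intro i j a hi hj h
    have h1 := hP i hi
    have h2 := hP j hj
    have h3 := hlt (a + P i)
    have h4 := hlt (a + P j)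
    simp only [F] at h
    split_ifs at h
    · omega
    · omega
    · omega
    · have := hcancel _ _ _ (by omega) (by omega) h
      simp only [P] at this
      split_ifs at this <;> omega
  have hcol : ∀ j a, j < m → F j a ≠ F j (a + 1) := by
    intro j a hj h
    have h1 := hP j hj
    have h2 := hlt (a + 1 + P j)
    simp only [F] at h
    rw [if_neg (by omega : ¬ (j = 0 ∧ a + 1 = 0))] at h
    split_ifs at h
    · omega
    · have := hnext _ _ _ (by omega) (by omega) h
      split_ifs at this <;> omega
  let c : (completeGraph (Fin m) □ pathGraph n).Coloring (Fin (m + 2)) :=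
    Coloring.mk (fun v => ⟨F v.1 v.2, hF _ _⟩) (by
      rintro ⟨i, a⟩ ⟨j, b⟩ hadj h
      have h := congrArg Fin.val h
      simp only [boxProd_adj, completeGraph_eq_top, top_adj, pathGraph_adj] at hadj h
      rcases hadj with ⟨hij, rfl⟩ | ⟨hab | hab, rfl⟩
      · exact hij (Fin.ext (hrow _ _ _ i.isLt j.isLt h))
      · rw [← hab] at h
        exact hcol i a i.isLt h
      · rw [← hab] at h
        exact hcol i b i.isLt h.symm)
  have hval : ∀ j a, (c (j, a)).val = F j a := fun _ _ => rfl
  have horigin : ∀ (i : Fin m) (a : Fin n), (c (i, a)).val = m + 1 ↔ i.val = 0 ∧ a.val = 0 := by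
    intro i a
    have := hlt (a + P i)
    rw [hval]
    simp only [F]
    split_ifs with h
    · simp [h]
    · simp only [h, iff_false]
      omega
  have hsurj : Function.Surjective c := fun x => by
    by_cases hx : x.val = m + 1
    · refine ⟨(⟨0, by omega⟩, ⟨0, by omega⟩), Fin.ext ?_⟩
      rw [hx, horigin]
      simp
    by_cases h1 : 1 ≤ x.val ∧ x.val < m
    · refine ⟨(⟨x.val, h1.2⟩, ⟨0, by omega⟩), Fin.ext ?_⟩
      have hx0 : x.val ≠ 0 := by omega
      rw [hval]
      simp only [F, P, hx0, false_and, if_false, Nat.zero_add]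
      exact Nat.mod_eq_of_lt (by omega)
    by_cases h0 : x.val = 0
    · refine ⟨(⟨0, by omega⟩, ⟨1, by omega⟩), Fin.ext ?_⟩
      rw [hval, h0]
      simp [F, P, Nat.add_comm 1 m]
    · refine ⟨(⟨m - 1, by omega⟩, ⟨1, by omega⟩), Fin.ext ?_⟩
      have hm1 : m - 1 ≠ 0 := by omega
      have hxm : x.val = m := by omega
      rw [hval, hxm]
      simp only [F, P, hm1, false_and, if_false]
      rw [Nat.add_sub_cancel' (by omega : 1 ≤ m)]
      exact Nat.mod_eq_of_lt (by omega)
  have hcode : ∀ (i : Fin m) (a : Fin n), colorCode c (i, a) (Fin.last (m + 1)) =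
      (if i.val = 0 then 0 else 1) + a.val := by
    intro i a
    obtain ⟨⟨l, b⟩, hu, e⟩ := exists_dist_eq_colorCode hsurj (i, a) (Fin.last (m + 1))
    obtain ⟨hl, hb⟩ := (horigin l b).mp (congrArg Fin.val hu)
    rw [e, dist_boxProd_complete_path]
    simp only [Fin.ext_iff, hl, hb]
    omega
  -- Since `P 0 = m`, column `0` of row `a + 1` has color `a` modulo `m + 1`, which row `a` omits.
  have hshift : ∀ (i j : Fin m) (a b : Fin n), i.val ≠ 0 → j.val = 0 → a.val + 1 = b.val →
      c (i, a) ≠ c (j, b) := by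
    intro i j a b hi hj hab h
    have h := congrArg Fin.val h
    rw [hval, hval, ← hab] at h
    simp only [F, hi, hj, false_and, if_false, Nat.add_eq_zero_iff, one_ne_zero, and_false] at h
    have := hnext _ _ _ (by have := hP i i.isLt; omega) (by have := hP 0 (by omega); omega) h
    simp only [P, hi, if_true, if_false] at this
  refine ⟨c, isLocating_of_same_color preconnected_complete_path hsurj ?_⟩
  rintro ⟨i, a⟩ ⟨j, b⟩ hcol hvw
  have h := congrFun hvw (Fin.last (m + 1))
  rw [hcode, hcode] at h
  by_cases hab : a = b
  · subst hab
    rw [row_injective hcol]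
  · have hab' : a.val ≠ b.val := fun h => hab (Fin.ext h)
    by_cases hi : i.val = 0
    · by_cases hj : j.val = 0
      · simp only [hi, hj, if_true] at h
        omega
      · simp only [hi, hj, if_true, if_false] at h
        exact absurd hcol.symm (hshift j i b a hj hi (by omega))
    · by_cases hj : j.val = 0
      · simp only [hi, hj, if_true, if_false] at h
        exact absurd hcol (hshift i j a b hi hj (by omega))
      · simp only [hi, hj, if_false] at h
        omega

end Product

end LocatingColoring

theorem theorem2 (m n : ℕ) (hm : 3 ≤ m) (hn : 2 ≤ n) :
    (m ≤ n - 2 →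
      LocatingColoring.locatingChromaticNumber
        (SimpleGraph.boxProd (SimpleGraph.completeGraph (Fin m)) (SimpleGraph.pathGraph n)) =
          m + 2) ∧
    (n - 1 ≤ m →
      LocatingColoring.locatingChromaticNumber
        (SimpleGraph.boxProd (SimpleGraph.completeGraph (Fin m)) (SimpleGraph.pathGraph n)) =
          m + 1) := by
  constructor
  · intro h
    refine IsLeast.csInf_eq ⟨LocatingColoring.exists_isLocating_add_two hm hn, ?_⟩
    rintro k ⟨c, hc⟩
    have hk := LocatingColoring.le_colors hn hm hc
    by_contra hlt
    obtain rfl : k = m + 1 := by omega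
    have := LocatingColoring.rows_le_of_isLocating hm hn hc
    omega
  · intro h
    refine IsLeast.csInf_eq
      ⟨LocatingColoring.exists_isLocating_of_rows_le hm hn (by omega), ?_⟩
    rintro k ⟨c, hc⟩
    exact LocatingColoring.le_colors hn hm hc
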